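/- Let $q$ denote an odd prime power, and let $\mathbb{F}_q[T]$ be the ring of polynomials over the finite field $\mathbb{F}_q$ with $q$ elements. For $n\ge 2$ let $B_q(n)$ be the number of monic polynomials $f\in\mathbb{F}_q[T]$ of degree $n$ for which there exist $A,B\in\mathbb{F}_q[T]$ with $f=A^2+TB^2$. Then for every $n\ge 2$, $$B_q(n)=\frac{1}{4^n}\binom{2n}{n}q^n+c_n q^{n-1}+O_n(q^{n-2}),\qquad q\to\infty,$$ where $$c_n=\frac{1}{2\cdot 4^{n-1}}\binom{2(n-1)}{n-1}+\frac{1}{4^{n-1}}\binom{2(n-2)}{n-2}.$$ That is, for every $n\ge 2$ there is a constant $C_n$, depending only on $n$, such that for all odd prime powers $q$ the difference of $B_q(n)$ and $\frac{1}{4^n}\binom{2n}{n}q^n+c_n q^{n-1}$ is at most $C_n q^{n-2}$ in absolute value. -/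

import Mathlib

open Polynomial

namespace LandauFF

/-- The set of monic polynomials of degree `n` in `F[T]` (the variable `T` is `X`). -/
def monicOfDegree (F : Type*) [Field F] (n : ℕ) : Set F[X] :=
  {f | f.Monic ∧ f.natDegree = n}

/-- `f` is of the form `A² + T B²` with `A, B ∈ F[T]`. -/
def IsRepresentable {F : Type*} [Field F] (f : F[X]) : Prop :=
  ∃ A B : F[X], f = A ^ 2 + X * B ^ 2

/-- The counting function `B_q(n)` for `F = 𝔽_q`: the number of monic `f` of degree `n` of the form
`A² + T B²`. For finite `F` the set counted is finite. -/
noncomputable def countRepresentable (F : Type*) [Field F] (n : ℕ) : ℕ :=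
  Set.ncard {f : F[X] | f ∈ monicOfDegree F n ∧ IsRepresentable f}

/-- The coefficient of the second term,
`c_n = (2·4^(n-1))⁻¹ binom(2(n-1), n-1) + (4^(n-1))⁻¹ binom(2(n-2), n-2)`; used for `2 ≤ n` only. -/
noncomputable def secondCoeff (n : ℕ) : ℝ :=
  1 / (2 * 4 ^ (n - 1)) * ((2 * (n - 1)).choose (n - 1) : ℝ)
    + 1 / 4 ^ (n - 1) * ((2 * (n - 2)).choose (n - 2) : ℝ)

end LandauFF

/-!
Write `B(u)` for the generating series of the monic polynomials of the form `A² + T B²`.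

*Which polynomials are counted.* A monic prime `P` with `P(0)` a nonsquare is called inert. A monic
`f` is of the form `A² + T B²` exactly when its inert prime factors have even multiplicity
(`isRepresentable_iff`). The form is multiplicative, so this comes down to primes. The norm of `-T`
from `F[T] / P` to `F` is `P(0)`, and an element of a finite field of odd characteristic is a square
exactly when its norm to a subfield is; hence `-T` is a square modulo `P` exactly when `P` is not
inert. For such `P` a dimension count (`exists_small_pair`) produces `A`, `B` with
`A² + T B² = c P` and `c` constant, and comparing values at `0` shows that `c` is a square. An inert
prime dividing `A² + T B²` divides both `A` and `B`.

*The generating series.* The Euler product of `B(u)` gives `B² = ζ L J` (`monicSeries_sq`), where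
`ζ(u) = 1 / (1 - q u)` counts all monic polynomials, `L` is the L-function of the quadratic
character of the constant term with the Euler factor of `T` put in, and
`J = ∏ (1 - u ^ (2 deg P))⁻¹` over inert `P` counts squares of products of inert primes. Character
sums over the constant term vanish, so `L(u) = 1 / (1 - u)`. The coefficients of `J` in odd degrees
are `0`, those in degrees `0` and `2` are `1` and `(q - 1) / 2`, and that in degree `2 m` is at most
`q ^ m`.

*The asymptotics.* Put `u = ε X` with `ε = 1 / q`. Then
`B² = (1 - X)⁻¹ (1 + ε X)(1 + (ε / 2) X²) + O(ε²)` coefficient by coefficient, so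
`B = (1 - X) ^ (-1/2) (1 + (ε / 2) X + (ε / 4) X²) + O(ε²)` (`abs_coeff_sub_le`). The coefficients
of `(1 - X) ^ (-1/2)` are `4⁻ⁿ binom(2n, n)`, and the coefficient of `Xⁿ` gives both terms.
-/

namespace LandauFF

open UniqueFactorizationMonoid

/-! ### Primes of the form `A² + T B²` -/

section Representable

variable {F : Type*} [Field F]

lemma IsRepresentable.mul {f g : F[X]} (hf : IsRepresentable f) (hg : IsRepresentable g) :
    IsRepresentable (f * g) := by
  obtain ⟨A, B, rfl⟩ := hf
  obtain ⟨C, D, rfl⟩ := hg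
  exact ⟨A * C - X * (B * D), A * D + B * C, by ring⟩

lemma isRepresentable_sq (f : F[X]) : IsRepresentable (f ^ 2) := ⟨f, 0, by ring⟩

lemma isRepresentable_one : IsRepresentable (1 : F[X]) := ⟨1, 0, by ring⟩

lemma IsRepresentable.pow {f : F[X]} (hf : IsRepresentable f) (k : ℕ) :
    IsRepresentable (f ^ k) := by
  induction k with
  | zero => simpa using isRepresentable_one
  | succ k ih => rw [pow_succ]; exact ih.mul hf

/-- A polynomial is *inert* if its value at `0` is not a square. A monic prime `P` is inert in this
sense exactly when `-T` is not a square modulo `P`, that is, when `P` stays prime in `F[√-T]`. -/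
def IsInert (P : F[X]) : Prop := ¬ IsSquare (P.coeff 0)

lemma norm_neg_root (P : F[X]) (hP : P.Monic) :
    Algebra.norm F (-AdjoinRoot.root P) = P.coeff 0 := by
  have hP0 : P ≠ 0 := hP.ne_zero
  have h1 := Algebra.PowerBasis.norm_gen_eq_coeff_zero_minpoly (AdjoinRoot.powerBasis hP0)
  rw [AdjoinRoot.powerBasis_gen, AdjoinRoot.minpoly_root hP0, AdjoinRoot.powerBasis_dim,
    hP.leadingCoeff, inv_one, C_1, mul_one] at h1
  have h2 : (-AdjoinRoot.root P : AdjoinRoot P)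
      = algebraMap F (AdjoinRoot P) (-1) * AdjoinRoot.root P := by simp
  rw [h2, map_mul, h1, Algebra.norm_algebraMap_of_basis (AdjoinRoot.powerBasis hP0).basis,
    Fintype.card_fin, AdjoinRoot.powerBasis_dim, ← mul_assoc, ← mul_pow]
  simp

/-- In an extension of finite fields of odd characteristic, an element whose norm is a square is
itself a square: both properties are read off from the same power of the element. -/
lemma isSquare_of_isSquare_norm [Finite F] (hF : ringChar F ≠ 2) {K : Type*} [Field K] [Finite K]
    [Algebra F K] {x : K} (h : IsSquare (Algebra.norm F x)) : IsSquare x := by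
  classical
  have := Fintype.ofFinite F
  have := Fintype.ofFinite K
  rcases eq_or_ne x 0 with rfl | hx
  · exact IsSquare.zero
  have hK : ringChar K ≠ 2 := by rwa [← Algebra.ringChar_eq F K]
  have hN : Algebra.norm F x ≠ 0 := by simpa [Algebra.norm_eq_zero_iff] using hx
  rw [FiniteField.isSquare_iff hF hN] at h
  rw [FiniteField.isSquare_iff hK hx]
  have h' := congrArg (algebraMap F K) h
  rw [map_pow, FiniteField.algebraMap_norm_eq_pow, map_one, ← pow_mul, Nat.card_eq_fintype_card,
    Nat.card_eq_fintype_card] at h'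
  have hodd : Fintype.card F % 2 = 1 := FiniteField.odd_card_of_char_ne_two hF
  have hoddK : Fintype.card K % 2 = 1 := FiniteField.odd_card_of_char_ne_two hK
  have hdvd : Fintype.card F - 1 ∣ Fintype.card K - 1 := by
    rw [Module.card_eq_pow_finrank (K := F) (V := K)]
    simpa using Nat.sub_dvd_pow_sub_pow (Fintype.card F) 1 (Module.finrank F K)
  obtain ⟨m, hm⟩ := hdvd
  have hF1 : 1 < Fintype.card F := Fintype.one_lt_card
  have e : (Fintype.card K - 1) / (Fintype.card F - 1) * (Fintype.card F / 2)
      = Fintype.card K / 2 := by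
    rw [hm, Nat.mul_div_cancel_left _ (by omega)]
    obtain ⟨k, hk⟩ : ∃ k, Fintype.card F = 2 * k + 1 := ⟨Fintype.card F / 2, by omega⟩
    have h3 : Fintype.card K = 2 * (k * m) + 1 := by
      have : 2 * k * m = 2 * (k * m) := by ring
      rw [hk, Nat.add_sub_cancel, this] at hm
      omega
    rw [h3, hk]
    have : (2 * k + 1) / 2 = k := by omega
    rw [this]
    have : (2 * (k * m) + 1) / 2 = k * m := by omega
    rw [this, mul_comm]
  rwa [e] at h'

lemma exists_dvd_sq_add_X [Finite F] (hF : ringChar F ≠ 2) {P : F[X]} (hm : P.Monic)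
    (hP : Irreducible P) (hi : ¬ IsInert P) : ∃ C : F[X], P ∣ C ^ 2 + X := by
  have := Fact.mk hP
  have : Module.Finite F (AdjoinRoot P) := (AdjoinRoot.powerBasis hm.ne_zero).finite
  have : Finite (AdjoinRoot P) := Module.finite_of_finite F
  have h : IsSquare (-AdjoinRoot.root P) := by
    apply isSquare_of_isSquare_norm hF
    rw [norm_neg_root P hm]
    exact not_not.mp hi
  obtain ⟨y, hy⟩ := h
  obtain ⟨C, rfl⟩ := AdjoinRoot.mk_surjective y
  refine ⟨C, AdjoinRoot.mk_eq_zero.mp ?_⟩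
  rw [map_add, AdjoinRoot.mk_X, map_pow, sq, ← hy]
  simp

lemma IsInert.not_dvd_sq_add_X {P : F[X]} (hm : P.Monic) (hi : IsInert P) (C : F[X]) :
    ¬ P ∣ C ^ 2 + X := by
  intro h
  have h' := AdjoinRoot.mk_eq_zero.mpr h
  rw [map_add, AdjoinRoot.mk_X, map_pow] at h'
  apply hi
  rw [← norm_neg_root P hm, ← eq_neg_of_add_eq_zero_left h', map_pow]
  exact ⟨_, sq _⟩

/-- An inert prime divides `A² + T B²` only if it divides both `A` and `B`; otherwise `-T` would be
the square of `A / B` modulo that prime. -/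
lemma IsInert.dvd_of_dvd {P : F[X]} (hm : P.Monic) (hP : Irreducible P) (hi : IsInert P)
    {A B : F[X]} (h : P ∣ A ^ 2 + X * B ^ 2) : P ∣ A ∧ P ∣ B := by
  have hB : P ∣ B := by
    by_contra hB
    obtain ⟨U, V, hUV⟩ := (hP.coprime_iff_not_dvd).mpr hB
    apply hi.not_dvd_sq_add_X hm (A * V)
    have : (A * V) ^ 2 + X = V ^ 2 * (A ^ 2 + X * B ^ 2) + P * (U * X * (1 + V * B)) := by
      linear_combination (-X * (1 + V * B)) * hUV
    rw [this]
    exact dvd_add (h.mul_left _) (dvd_mul_right _ _)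
  refine ⟨?_, hB⟩
  have : P ∣ A ^ 2 := (dvd_add_left ((dvd_pow hB two_ne_zero).mul_left X)).mp h
  exact hP.prime.dvd_of_dvd_pow this

/-- Thue's lemma in `F[T]`: modulo `P` of degree `d`, every `C` is a quotient `A / B` with
`2 deg A ≤ d` and `2 deg B < d`, since such pairs form a space of dimension `d + 1`. -/
lemma exists_small_pair {P : F[X]} (hm : P.Monic) (hd : 0 < P.natDegree) (C : F[X]) :
    ∃ A B : F[X], (A ≠ 0 ∨ B ≠ 0) ∧ 2 * A.natDegree ≤ P.natDegree ∧
      2 * B.natDegree + 1 ≤ P.natDegree ∧ P ∣ A - C * B := by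
  set d := P.natDegree with hdd
  let V := degreeLT F (d / 2 + 1) × degreeLT F ((d - 1) / 2 + 1)
  let φ : V →ₗ[F] AdjoinRoot P :=
    (AdjoinRoot.mkₐ P).toLinearMap ∘ₗ ((degreeLT F _).subtype ∘ₗ LinearMap.fst F _ _
      - LinearMap.mulLeft F C ∘ₗ (degreeLT F _).subtype ∘ₗ LinearMap.snd F _ _)
  have : Module.Finite F (AdjoinRoot P) := (AdjoinRoot.powerBasis hm.ne_zero).finite
  have fr (k : ℕ) : Module.finrank F (degreeLT F k) = k := by
    rw [(degreeLTEquiv F k).finrank_eq]; simp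
  have hfin (k : ℕ) : Module.Finite F (degreeLT F k) :=
    Module.Finite.equiv (degreeLTEquiv F k).symm
  have hlt : Module.finrank F (AdjoinRoot P) < Module.finrank F V := by
    rw [Module.finrank_prod, fr, fr, (AdjoinRoot.powerBasis hm.ne_zero).finrank,
      AdjoinRoot.powerBasis_dim]
    omega
  obtain ⟨⟨⟨A, hA⟩, ⟨B, hB⟩⟩, hv, hv0⟩ :=
    (Submodule.ne_bot_iff _).mp (LinearMap.ker_ne_bot_of_finrank_lt (f := φ) hlt)
  have natlt {k : ℕ} {Q : F[X]} (hQ : Q ∈ degreeLT F (k + 1)) : Q.natDegree ≤ k := by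
    rw [mem_degreeLT] at hQ
    exact natDegree_le_of_degree_le (Order.le_of_lt_succ hQ)
  refine ⟨A, B, ?_, ?_, ?_, ?_⟩
  · by_contra! h
    apply hv0
    obtain ⟨rfl, rfl⟩ := h
    rfl
  · have := natlt hA; omega
  · have := natlt hB; omega
  · exact AdjoinRoot.mk_eq_zero.mp hv

lemma add_X_mul_sq_ne_zero {A B : F[X]} (h : A ≠ 0 ∨ B ≠ 0) : A ^ 2 + X * B ^ 2 ≠ 0 := by
  intro h0
  have h1 : A ^ 2 = -(X * B ^ 2) := eq_neg_of_add_eq_zero_left h0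
  rcases eq_or_ne B 0 with rfl | hB
  · simp at h1; simp_all
  have h2 := congrArg natDegree h1
  rw [natDegree_neg, natDegree_pow, natDegree_X_mul (pow_ne_zero 2 hB), natDegree_pow] at h2
  omega

/-- A monic prime that is not inert is of the form `A² + T B²`. -/
lemma isRepresentable_of_not_isInert [Finite F] (hF : ringChar F ≠ 2) {P : F[X]} (hm : P.Monic)
    (hP : Irreducible P) (hi : ¬ IsInert P) : IsRepresentable P := by
  rcases eq_or_ne (P.coeff 0) 0 with h0 | h0
  · have hX : X ∣ P := X_dvd_iff.mpr h0
    have : X = P := eq_of_monic_of_associated monic_X hm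
      (Polynomial.irreducible_X.associated_of_dvd hP hX)
    exact ⟨0, 1, by rw [← this]; ring⟩
  obtain ⟨C, hC⟩ := exists_dvd_sq_add_X hF hm hP hi
  obtain ⟨A, B, hAB, hA, hB, h⟩ := exists_small_pair hm hP.natDegree_pos C
  have hdvd : P ∣ A ^ 2 + X * B ^ 2 := by
    have : A ^ 2 + X * B ^ 2 = (A - C * B) * (A + C * B) + (C ^ 2 + X) * B ^ 2 := by ring
    rw [this]
    exact dvd_add (h.mul_right _) (hC.mul_right _)
  obtain ⟨c, hc⟩ := hdvd
  have hne := add_X_mul_sq_ne_zero hAB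
  have hc0 : c ≠ 0 := by rintro rfl; simp_all
  have hdeg : (A ^ 2 + X * B ^ 2).natDegree ≤ P.natDegree := by
    refine natDegree_add_le_of_degree_le ?_ ?_
    · rw [natDegree_pow]; exact hA
    · refine natDegree_mul_le.trans ?_
      rw [natDegree_X, natDegree_pow]; omega
  rw [hc, natDegree_mul hm.ne_zero hc0] at hdeg
  obtain ⟨a, rfl⟩ := natDegree_eq_zero.mp (show c.natDegree = 0 by omega)
  have ha0 : a ≠ 0 := by rintro rfl; simp at hc0
  -- Comparing values at `0` shows that the leftover constant is a square.
  have hev : A.coeff 0 ^ 2 = P.coeff 0 * a := by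
    have := congrArg (fun Q : F[X] => Q.coeff 0) hc
    simpa [mul_coeff_zero, coeff_zero_eq_eval_zero] using this
  obtain ⟨s, hs⟩ := not_not.mp hi
  have hA0 : A.coeff 0 ≠ 0 := by
    intro h; rw [h] at hev
    exact mul_ne_zero h0 ha0 (by rw [← hev]; ring)
  have hs0 : s ≠ 0 := by rintro rfl; simp_all
  set e := s / A.coeff 0 with he
  have hae : a * e ^ 2 = 1 := by
    rw [he, div_pow, hev, hs]; field_simp
  refine ⟨Polynomial.C e * A, Polynomial.C e * B, ?_⟩
  calc P = P * Polynomial.C (a * e ^ 2) := by rw [hae]; simp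
    _ = (P * Polynomial.C a) * Polynomial.C e ^ 2 := by rw [C_mul, C_pow]; ring
    _ = _ := by rw [← hc]; ring

end Representable

/-! ### Factorization of the polynomials `A² + T B²` -/

section Factors

variable {F : Type*} [Field F]

open scoped Classical in
/-- The monic polynomials whose prime factors `P` all lie in `R` and occur with a multiplicity
divisible by `e P`. -/
def factoredMonics (R : Set F[X]) (e : F[X] → ℕ) : Set F[X] :=
  {f | f.Monic ∧ ∀ P ∈ normalizedFactors f, P ∈ R ∧ e P ∣ (normalizedFactors f).count P}

open scoped Classical in
lemma monic_of_mem_normalizedFactors {f P : F[X]} (h : P ∈ normalizedFactors f) : P.Monic := by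
  rw [← normalize_normalized_factor P h]
  exact monic_normalize (irreducible_of_normalized_factor P h).ne_zero

open scoped Classical in
lemma prod_normalizedFactors_of_monic {f : F[X]} (hf : f.Monic) :
    (normalizedFactors f).prod = f := by
  rw [prod_normalizedFactors_eq hf.ne_zero, hf.normalize_eq_self]

open scoped Classical in
lemma mem_normalizedFactors_iff_of_monic {f P : F[X]} (hf : f.Monic) (hP : P.Monic)
    (hi : Irreducible P) : P ∈ normalizedFactors f ↔ P ∣ f := by
  rw [mem_normalizedFactors_iff' hf.ne_zero]
  exact ⟨fun h => h.2.2, fun h => ⟨hi, hP.normalize_eq_self, h⟩⟩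

open scoped Classical in
lemma normalizedFactors_pow_mul {P g : F[X]} (hP : P.Monic) (hi : Irreducible P) (hg : g ≠ 0)
    (k : ℕ) : normalizedFactors (P ^ k * g) = Multiset.replicate k P + normalizedFactors g := by
  rw [normalizedFactors_mul (pow_ne_zero k hi.ne_zero) hg, hi.normalizedFactors_pow,
    hP.normalize_eq_self]

open scoped Classical in
lemma pow_mem_factoredMonics {R : Set F[X]} {e : F[X] → ℕ} {P : F[X]} (hP : P.Monic)
    (hi : Irreducible P) (hPR : P ∈ R) {k : ℕ} (hk : e P ∣ k) : P ^ k ∈ factoredMonics R e := by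
  refine ⟨hP.pow k, fun Q hQ => ?_⟩
  rw [hi.normalizedFactors_pow, hP.normalize_eq_self] at hQ ⊢
  rw [Multiset.eq_of_mem_replicate hQ, Multiset.count_replicate_self]
  exact ⟨hPR, hk⟩

open scoped Classical in
/-- Inert primes occur in `A² + T B²` with even multiplicity. -/
lemma IsRepresentable.even_count {P : F[X]} (hm : P.Monic) (hP : Irreducible P) (hi : IsInert P)
    {f : F[X]} (hf : IsRepresentable f) (hf0 : f ≠ 0) :
    2 ∣ (normalizedFactors f).count P := by
  induction h : f.natDegree using Nat.strong_induction_on generalizing f with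
  | _ n ih =>
    by_cases hdvd : P ∣ f
    · obtain ⟨A, B, rfl⟩ := hf
      obtain ⟨⟨A, rfl⟩, ⟨B, rfl⟩⟩ := hi.dvd_of_dvd hm hP hdvd
      have e : (P * A) ^ 2 + X * (P * B) ^ 2 = P ^ 2 * (A ^ 2 + X * B ^ 2) := by ring
      rw [e] at hf0 h ⊢
      have h0 : A ^ 2 + X * B ^ 2 ≠ 0 := right_ne_zero_of_mul hf0
      rw [normalizedFactors_pow_mul hm hP h0, Multiset.count_add, Multiset.count_replicate_self]
      refine dvd_add dvd_rfl (ih _ ?_ ⟨A, B, rfl⟩ h0 rfl)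
      rw [natDegree_mul (left_ne_zero_of_mul hf0) h0, natDegree_pow] at h
      have := hP.natDegree_pos
      omega
    · rw [Multiset.count_eq_zero.mpr fun h => hdvd (dvd_of_mem_normalizedFactors h)]
      exact dvd_zero 2

open scoped Classical in
/-- The exponent `2` at inert primes and `1` at all others. -/
noncomputable def inertExponent (P : F[X]) : ℕ := if IsInert P then 2 else 1

/-- A monic polynomial is of the form `A² + T B²` if and only if its inert prime factors occur with
even multiplicity. -/
theorem isRepresentable_iff [Finite F] (hF : ringChar F ≠ 2) {f : F[X]} (hf : f.Monic) :
    IsRepresentable f ↔ f ∈ factoredMonics Set.univ (inertExponent (F := F)) := by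
  classical
  constructor
  · refine fun h => ⟨hf, fun P hP => ⟨trivial, ?_⟩⟩
    unfold inertExponent
    split_ifs with hi
    · convert! h.even_count (monic_of_mem_normalizedFactors hP)
        (irreducible_of_normalized_factor P hP) hi hf.ne_zero
    · exact one_dvd _
  · rintro ⟨-, h⟩
    rw [← prod_normalizedFactors_of_monic hf, Finset.prod_multiset_count]
    refine Finset.prod_induction _ IsRepresentable (fun _ _ => IsRepresentable.mul)
      isRepresentable_one fun P hP => ?_
    have hP' := Multiset.mem_toFinset.mp hP
    by_cases hi : IsInert P
    · obtain ⟨k, hk⟩ := (h P (by convert! hP')).2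
      rw [inertExponent, if_pos hi] at hk
      have : P ^ (normalizedFactors f).count P = (P ^ k) ^ 2 := by
        rw [← pow_mul, mul_comm k 2, ← hk]
      rw [this]
      exact isRepresentable_sq _
    · exact (isRepresentable_of_not_isInert hF (monic_of_mem_normalizedFactors hP')
        (irreducible_of_normalized_factor P hP') hi).pow _

/-- If all prime factors of a monic polynomial occur with even multiplicity, it is a square. -/
lemma exists_sq_eq_of_mem_factoredMonics {R : Set F[X]} {f : F[X]}
    (hf : f ∈ factoredMonics R (fun _ => 2)) : ∃ g : F[X], g.Monic ∧ f = g ^ 2 := by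
  classical
  obtain ⟨hm, h⟩ := hf
  refine ⟨∏ P ∈ (normalizedFactors f).toFinset, P ^ ((normalizedFactors f).count P / 2), ?_, ?_⟩
  · exact monic_prod_of_monic _ _ fun P hP =>
      (monic_of_mem_normalizedFactors (Multiset.mem_toFinset.mp hP)).pow _
  · rw [← Finset.prod_pow]
    conv_lhs => rw [← prod_normalizedFactors_of_monic hm, Finset.prod_multiset_count]
    refine Finset.prod_congr rfl fun P hP => ?_
    rw [← pow_mul, Nat.div_mul_cancel]
    convert! (h P (by convert! Multiset.mem_toFinset.mp hP)).2

open scoped Classical in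
/-- Allowing one more prime `P`: either `P` does not occur, or `P ^ e P` splits off. -/
lemma factoredMonics_insert {R : Set F[X]} {e : F[X] → ℕ} {P : F[X]} (hm : P.Monic)
    (hi : Irreducible P) (hPR : P ∉ R) (he : 0 < e P) :
    factoredMonics (insert P R) e
      = factoredMonics R e ∪ (P ^ e P * ·) '' factoredMonics (insert P R) e := by
  ext f
  constructor
  · rintro ⟨hf, h⟩
    by_cases hP : P ∈ normalizedFactors f
    · right
      obtain ⟨m, hcm⟩ := (h P hP).2
      have hc := Multiset.count_pos.mpr hP
      have hle : e P ≤ (normalizedFactors f).count P := Nat.le_of_dvd hc ⟨m, hcm⟩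
      have hdvd : P ^ e P ∣ f := by
        conv_rhs => rw [← prod_normalizedFactors_of_monic hf]
        rw [← Multiset.prod_replicate]
        exact Multiset.prod_dvd_prod_of_le (Multiset.le_count_iff_replicate_le.mp hle)
      obtain ⟨g, rfl⟩ := hdvd
      have hg : g.Monic := (hm.pow _).of_mul_monic_left hf
      refine ⟨g, ⟨hg, fun Q hQ => ?_⟩, rfl⟩
      rw [normalizedFactors_pow_mul hm hi hg.ne_zero] at h
      have hQ' := h Q (Multiset.mem_add.mpr (Or.inr hQ))
      refine ⟨hQ'.1, ?_⟩
      have h2 := hQ'.2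
      rw [Multiset.count_add, Multiset.count_replicate] at h2
      split_ifs at h2 with hPQ
      · subst hPQ
        exact (Nat.dvd_add_right dvd_rfl).mp h2
      · simpa using h2
    · left
      refine ⟨hf, fun Q hQ => ⟨(h Q hQ).1.resolve_left ?_, (h Q hQ).2⟩⟩
      rintro rfl
      exact hP hQ
  · rintro (⟨hf, h⟩ | ⟨g, ⟨hg, h⟩, rfl⟩)
    · exact ⟨hf, fun Q hQ => ⟨Or.inr (h Q hQ).1, (h Q hQ).2⟩⟩
    · refine ⟨(hm.pow _).mul hg, fun Q hQ => ?_⟩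
      rw [normalizedFactors_pow_mul hm hi hg.ne_zero] at hQ ⊢
      rw [Multiset.count_add, Multiset.count_replicate]
      by_cases hQg : Q ∈ normalizedFactors g
      · refine ⟨(h Q hQg).1, ?_⟩
        split_ifs with hPQ
        · subst hPQ; exact dvd_add dvd_rfl (h _ hQg).2
        · simpa using (h Q hQg).2
      · have hQP : Q = P := by
          rcases Multiset.mem_add.mp hQ with h1 | h1
          · exact Multiset.eq_of_mem_replicate h1
          · exact absurd h1 hQg
        subst hQP
        refine ⟨Or.inl rfl, ?_⟩
        rw [Multiset.count_eq_zero.mpr hQg]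
        simp

lemma factoredMonics_empty (e : F[X] → ℕ) : factoredMonics (∅ : Set F[X]) e = {1} := by
  classical
  ext f
  constructor
  · rintro ⟨hf, h⟩
    have : normalizedFactors f = 0 :=
      Multiset.eq_zero_of_forall_notMem fun P hP => (h P (by convert! hP)).1
    rw [Set.mem_singleton_iff, ← prod_normalizedFactors_of_monic hf, this, Multiset.prod_zero]
  · rintro rfl
    exact ⟨monic_one, by simp⟩

lemma disjoint_factoredMonics_image {R R' : Set F[X]} {e : F[X] → ℕ} {P : F[X]} (hm : P.Monic)
    (hi : Irreducible P) (hPR : P ∉ R) (he : 0 < e P) :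
    Disjoint (factoredMonics R e) ((P ^ e P * ·) '' R') := by
  classical
  rw [Set.disjoint_left]
  rintro _ ⟨hf, h⟩ ⟨g, -, rfl⟩
  refine hPR (h P ?_).1
  exact (mem_normalizedFactors_iff_of_monic hf hm hi).mpr
    ((dvd_pow_self P he.ne').mul_right g)

end Factors

/-! ### Generating series over monic polynomials and their Euler products -/

section Series

variable {F : Type*} [Field F]

lemma monicOfDegree_zero : monicOfDegree F 0 = {1} := by
  ext f
  exact ⟨fun h => h.1.natDegree_eq_zero.mp h.2, by rintro rfl; exact ⟨monic_one, natDegree_one⟩⟩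

lemma X_mul_add_C_mem_monicOfDegree {n : ℕ} {g : F[X]} (hg : g ∈ monicOfDegree F n) (c : F) :
    X * g + C c ∈ monicOfDegree F (n + 1) := by
  have hd : (X * g).natDegree = n + 1 := by rw [natDegree_X_mul hg.1.ne_zero, hg.2]
  constructor
  · refine (monic_X.mul hg.1).add_of_left (degree_C_le.trans_lt ?_)
    rw [degree_eq_natDegree (monic_X.mul hg.1).ne_zero, hd]
    exact_mod_cast n.succ_pos
  · rw [natDegree_add_C, hd]

lemma divX_mem_monicOfDegree {n : ℕ} {f : F[X]} (hf : f ∈ monicOfDegree F (n + 1)) :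
    divX f ∈ monicOfDegree F n := by
  have hd : f.divX.natDegree = n := by rw [natDegree_divX_eq_natDegree_tsub_one, hf.2]; rfl
  refine ⟨?_, hd⟩
  rw [Monic, leadingCoeff, hd, coeff_divX, ← hf.2]
  exact hf.1

lemma monicOfDegree_succ (n : ℕ) : monicOfDegree F (n + 1)
    = (fun p : F[X] × F => X * p.1 + C p.2) '' (monicOfDegree F n ×ˢ Set.univ) := by
  ext f
  constructor
  · exact fun h => ⟨(divX f, f.coeff 0), ⟨divX_mem_monicOfDegree h, trivial⟩, X_mul_divX_add f⟩
  · rintro ⟨⟨g, c⟩, ⟨hg, -⟩, rfl⟩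
    exact X_mul_add_C_mem_monicOfDegree hg c

lemma X_mul_add_C_injective : Function.Injective (fun p : F[X] × F => X * p.1 + C p.2) := by
  rintro ⟨g, c⟩ ⟨g', c'⟩ h
  have h' : X * g + C c = X * g' + C c' := h
  have hc : c = c' := by simpa using congrArg (fun f : F[X] => f.coeff 0) h'
  subst hc
  simpa using h'

/-- The generating series `∑ w(f) u ^ deg f` over the monic polynomials `f` in `M`. -/
noncomputable def monicSeries (w : F[X] →* ℝ) (M : Set F[X]) : PowerSeries ℝ :=
  PowerSeries.mk fun n => ∑ᶠ f ∈ monicOfDegree F n ∩ M, w f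

lemma coeff_monicSeries (w : F[X] →* ℝ) (M : Set F[X]) (n : ℕ) :
    PowerSeries.coeff n (monicSeries w M) = ∑ᶠ f ∈ monicOfDegree F n ∩ M, w f :=
  PowerSeries.coeff_mk _ _

lemma monicOfDegree_inter_image {Q : F[X]} (hQ : Q.Monic) (M : Set F[X]) (n : ℕ) :
    monicOfDegree F n ∩ (Q * ·) '' M
      = (Q * ·) '' {g | g ∈ M ∧ g.Monic ∧ Q.natDegree + g.natDegree = n} := by
  ext f
  constructor
  · rintro ⟨⟨hf, hn⟩, g, hg, rfl⟩
    have hgm : g.Monic := hQ.of_mul_monic_left hf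
    exact ⟨g, ⟨hg, hgm, by rw [← hn, hQ.natDegree_mul hgm]⟩, rfl⟩
  · rintro ⟨g, ⟨hg, hgm, hn⟩, rfl⟩
    exact ⟨⟨hQ.mul hgm, by rw [hQ.natDegree_mul hgm, hn]⟩, g, hg, rfl⟩

variable [Finite F]

lemma finite_monicOfDegree (n : ℕ) : (monicOfDegree F n).Finite := by
  induction n with
  | zero => rw [monicOfDegree_zero]; exact Set.finite_singleton 1
  | succ n ih => rw [monicOfDegree_succ]; exact (ih.prod Set.finite_univ).image _

lemma finsum_monicOfDegree_succ [Fintype F] (w : F[X] → ℝ) (n : ℕ) :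
    ∑ᶠ f ∈ monicOfDegree F (n + 1), w f
      = ∑ᶠ g ∈ monicOfDegree F n, ∑ c : F, w (X * g + C c) := by
  classical
  rw [monicOfDegree_succ, finsum_mem_image X_mul_add_C_injective.injOn,
    finsum_mem_eq_finite_toFinset_sum _ (finite_monicOfDegree n)]
  have : monicOfDegree F n ×ˢ (Set.univ : Set F)
      = ↑((finite_monicOfDegree (F := F) n).toFinset ×ˢ (Finset.univ : Finset F)) := by
    ext; simp
  rw [this, finsum_mem_coe_finset, Finset.sum_product]

/-- Splitting off a factor `Q` in a set of monic polynomials gives one Euler factor. -/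
lemma one_sub_mul_monicSeries (w : F[X] →* ℝ) {M M' : Set F[X]} {Q : F[X]} (hQ : Q.Monic)
    (hM : M' = M ∪ (Q * ·) '' M') (hd : Disjoint M ((Q * ·) '' M')) :
    (1 - PowerSeries.C (w Q) * PowerSeries.X ^ Q.natDegree) * monicSeries w M'
      = monicSeries w M := by
  ext n
  rw [sub_mul, one_mul, map_sub, mul_assoc, PowerSeries.coeff_C_mul, PowerSeries.coeff_X_pow_mul',
    coeff_monicSeries, coeff_monicSeries, coeff_monicSeries]
  have h1 : monicOfDegree F n ∩ M'
      = (monicOfDegree F n ∩ M) ∪ (monicOfDegree F n ∩ (Q * ·) '' M') := by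
    rw [← Set.inter_union_distrib_left, ← hM]
  rw [h1, finsum_mem_union (hd.mono Set.inter_subset_right Set.inter_subset_right)
      ((finite_monicOfDegree n).inter_of_left _) ((finite_monicOfDegree n).inter_of_left _),
    monicOfDegree_inter_image hQ,
    finsum_mem_image (mul_right_injective₀ hQ.ne_zero).injOn, add_sub_assoc, add_eq_left,
    sub_eq_zero]
  split_ifs with hn
  · have h2 : {g | g ∈ M' ∧ g.Monic ∧ Q.natDegree + g.natDegree = n}
        = monicOfDegree F (n - Q.natDegree) ∩ M' := by
      ext g
      simp only [Set.mem_ofPred_eq, Set.mem_inter_iff, monicOfDegree]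
      constructor
      · rintro ⟨a, b, c⟩; exact ⟨⟨b, by omega⟩, a⟩
      · rintro ⟨⟨b, c⟩, a⟩; exact ⟨a, b, by omega⟩
    rw [h2, mul_finsum_mem]
    simp only [map_mul]
  · have h2 : {g | g ∈ M' ∧ g.Monic ∧ Q.natDegree + g.natDegree = n} = ∅ := by
      ext g
      simp only [Set.mem_ofPred_eq, Set.mem_empty_iff_false, iff_false]
      rintro ⟨-, -, c⟩; omega
    rw [h2, finsum_mem_empty, mul_zero]

/-- The Euler product over a finite set of primes. -/
theorem prod_mul_monicSeries (w : F[X] →* ℝ) (e : F[X] → ℕ) (S : Finset F[X])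
    (hS : ∀ P ∈ S, P.Monic ∧ Irreducible P ∧ 0 < e P) :
    (∏ P ∈ S, (1 - PowerSeries.C (w P ^ e P) * PowerSeries.X ^ (e P * P.natDegree)))
      * monicSeries w (factoredMonics (S : Set F[X]) e) = 1 := by
  classical
  induction S using Finset.induction_on with
  | empty =>
    ext n
    rw [Finset.prod_empty, one_mul, coeff_monicSeries, Finset.coe_empty, factoredMonics_empty,
      PowerSeries.coeff_one]
    split_ifs with hn
    · subst hn; rw [monicOfDegree_zero, Set.inter_self, finsum_mem_singleton, map_one]
    · have : monicOfDegree F n ∩ {1} = ∅ := by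
        ext f
        simp only [Set.mem_inter_iff, Set.mem_singleton_iff, Set.mem_empty_iff_false, iff_false]
        rintro ⟨⟨-, h⟩, rfl⟩
        exact hn (by rw [← h, natDegree_one])
      rw [this, finsum_mem_empty]
  | insert P S hPS ih =>
    obtain ⟨hm, hi, he⟩ := hS P (Finset.mem_insert_self P S)
    rw [Finset.prod_insert hPS, mul_comm (1 - _), mul_assoc, Finset.coe_insert]
    have := one_sub_mul_monicSeries w (hm.pow (e P))
      (factoredMonics_insert (R := (S : Set F[X])) hm hi (by simpa using hPS) he)
      (disjoint_factoredMonics_image hm hi (by simpa using hPS) he)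
    rw [map_pow, hm.natDegree_pow] at this
    rw [this]
    exact ih fun Q hQ => hS Q (Finset.mem_insert_of_mem hQ)

variable (F) in
/-- The monic primes of degree at most `N`. -/
noncomputable def primesUpTo (N : ℕ) : Finset F[X] :=
  Set.Finite.toFinset (s := {P : F[X] | (P.Monic ∧ Irreducible P) ∧ P.natDegree ≤ N}) <| by
    refine ((Set.finite_le_nat N).biUnion fun k _ => finite_monicOfDegree (F := F) k).subset ?_
    rintro P ⟨⟨hm, -⟩, hN⟩
    exact Set.mem_biUnion hN ⟨hm, rfl⟩

lemma mem_primesUpTo {N : ℕ} {P : F[X]} :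
    P ∈ primesUpTo F N ↔ (P.Monic ∧ Irreducible P) ∧ P.natDegree ≤ N := by
  simp [primesUpTo]

/-- The coefficients up to `N` only see primes of degree at most `N`. -/
lemma coeff_monicSeries_factoredMonics (w : F[X] →* ℝ) (R : Set F[X]) (e : F[X] → ℕ) {k N : ℕ}
    (hk : k ≤ N) (S : Finset F[X]) (hS : (S : Set F[X]) = R ∩ primesUpTo F N) :
    PowerSeries.coeff k (monicSeries w (factoredMonics R e))
      = PowerSeries.coeff k (monicSeries w (factoredMonics (S : Set F[X]) e)) := by
  classical
  have key : monicOfDegree F k ∩ factoredMonics R e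
      = monicOfDegree F k ∩ factoredMonics (S : Set F[X]) e := by
    rw [hS]
    ext f
    refine and_congr_right ?_
    rintro ⟨hf, hd⟩
    refine ⟨fun h => ⟨hf, fun P hP => ⟨⟨(h.2 P hP).1, ?_⟩, (h.2 P hP).2⟩⟩,
      fun h => ⟨hf, fun P hP => ⟨(h.2 P hP).1.1, (h.2 P hP).2⟩⟩⟩
    have hP' : P ∈ normalizedFactors f := by convert! hP
    refine Finset.mem_coe.mpr (mem_primesUpTo.mpr ⟨⟨monic_of_mem_normalizedFactors hP',
      irreducible_of_normalized_factor P hP'⟩, ?_⟩)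
    have := natDegree_le_of_dvd (dvd_of_mem_normalizedFactors hP') hf.ne_zero
    omega
  rw [coeff_monicSeries, coeff_monicSeries, key]

end Series

/-! ### The square of the generating series -/

section Identity

variable {F : Type*} [Field F]

lemma finsum_mem_one_eq_ncard {α : Type*} {S : Set α} (hS : S.Finite) :
    ∑ᶠ a ∈ S, (1 : ℝ) = S.ncard := by
  rw [finsum_mem_eq_finite_toFinset_sum _ hS, Finset.sum_const, Set.ncard_eq_toFinset_card _ hS]
  simp

lemma trailingCoeff_of_coeff_zero {f : F[X]} (h : f.coeff 0 ≠ 0) :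
    f.trailingCoeff = f.coeff 0 := by
  rw [trailingCoeff, natTrailingDegree_eq_zero.mpr (Or.inr h)]

lemma mem_factoredMonics_one {f : F[X]} : f ∈ factoredMonics Set.univ (fun _ => 1) ↔ f.Monic :=
  ⟨fun h => h.1, fun h => ⟨h, fun _ _ => ⟨trivial, one_dvd _⟩⟩⟩

lemma monicOfDegree_inter_factoredMonics_one (n : ℕ) :
    monicOfDegree F n ∩ factoredMonics Set.univ (fun _ => 1) = monicOfDegree F n :=
  Set.inter_eq_left.mpr fun _ hf => mem_factoredMonics_one.mpr hf.1

lemma coeff_mul_congr {f f' g g' : PowerSeries ℝ} {N : ℕ}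
    (hf : ∀ k ≤ N, PowerSeries.coeff k f = PowerSeries.coeff k f')
    (hg : ∀ k ≤ N, PowerSeries.coeff k g = PowerSeries.coeff k g') :
    ∀ k ≤ N, PowerSeries.coeff k (f * g) = PowerSeries.coeff k (f' * g') := by
  intro k hk
  rw [PowerSeries.coeff_mul, PowerSeries.coeff_mul]
  refine Finset.sum_congr rfl fun p hp => ?_
  have := Finset.HasAntidiagonal.mem_antidiagonal.mp hp
  rw [hf _ (by omega), hg _ (by omega)]

lemma monicOfDegree_inter_factoredMonics_two_subset (n : ℕ) (R : Set F[X]) :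
    monicOfDegree F n ∩ factoredMonics R (fun _ => 2)
      ⊆ (· ^ 2) '' {g | g.Monic ∧ 2 * g.natDegree = n} := by
  rintro f ⟨⟨-, hn⟩, hf⟩
  obtain ⟨g, hg, rfl⟩ := exists_sq_eq_of_mem_factoredMonics hf
  exact ⟨g, ⟨hg, by rw [← hn, natDegree_pow]⟩, rfl⟩

/-- The generating series of the squares of products of inert primes, `∏ (1 - u ^ (2 deg P))⁻¹`. -/
noncomputable def inertSquareSeries (F : Type*) [Field F] : PowerSeries ℝ :=
  monicSeries (1 : F[X] →* ℝ) (factoredMonics {P | IsInert P} (fun _ => 2))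

lemma coeff_zero_inertSquareSeries : PowerSeries.coeff 0 (inertSquareSeries F) = 1 := by
  rw [inertSquareSeries, coeff_monicSeries, monicOfDegree_zero]
  have : ({1} : Set F[X]) ∩ factoredMonics {P | IsInert P} (fun _ => 2) = {1} := by
    refine Set.inter_eq_left.mpr ?_
    rintro _ rfl
    exact ⟨monic_one, by simp⟩
  rw [this, finsum_mem_singleton, map_one]

lemma ncard_monicOfDegree (n : ℕ) : (monicOfDegree F n).ncard = Nat.card F ^ n := by
  induction n with
  | zero => rw [monicOfDegree_zero, Set.ncard_singleton, pow_zero]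
  | succ n ih =>
    rw [monicOfDegree_succ, Set.ncard_image_of_injective _ X_mul_add_C_injective, Set.ncard_prod,
      ih, Set.ncard_univ, pow_succ]

section Finite

variable [Finite F]

/-- The zeta function of `F[T]` is `1 / (1 - q u)`. -/
lemma coeff_monicSeries_one (n : ℕ) :
    PowerSeries.coeff n (monicSeries (1 : F[X] →* ℝ) (factoredMonics Set.univ (fun _ => 1)))
      = (Nat.card F : ℝ) ^ n := by
  rw [coeff_monicSeries, monicOfDegree_inter_factoredMonics_one]
  simp only [MonoidHom.one_apply]
  rw [finsum_mem_one_eq_ncard (finite_monicOfDegree n), ncard_monicOfDegree, Nat.cast_pow]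

lemma coeff_inertSquareSeries (n : ℕ) : PowerSeries.coeff n (inertSquareSeries F)
    = (monicOfDegree F n ∩ factoredMonics {P | IsInert P} (fun _ => 2)).ncard := by
  rw [inertSquareSeries, coeff_monicSeries]
  simp only [MonoidHom.one_apply]
  rw [finsum_mem_one_eq_ncard ((finite_monicOfDegree n).inter_of_left _)]

lemma coeff_inertSquareSeries_of_odd (n : ℕ) (hn : Odd n) :
    PowerSeries.coeff n (inertSquareSeries F) = 0 := by
  rw [coeff_inertSquareSeries]
  have : monicOfDegree F n ∩ factoredMonics {P | IsInert P} (fun _ => 2) = ∅ := by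
    refine Set.subset_empty_iff.mp fun f hf => ?_
    obtain ⟨g, ⟨-, hg⟩, -⟩ := monicOfDegree_inter_factoredMonics_two_subset n _ hf
    obtain ⟨k, hk⟩ := hn
    omega
  rw [this]; simp

lemma coeff_inertSquareSeries_le (m : ℕ) :
    PowerSeries.coeff (2 * m) (inertSquareSeries F) ≤ (Nat.card F : ℝ) ^ m := by
  rw [coeff_inertSquareSeries, ← Nat.cast_pow, Nat.cast_le, ← ncard_monicOfDegree]
  have h : {g : F[X] | g.Monic ∧ 2 * g.natDegree = 2 * m} = monicOfDegree F m := by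
    ext g; simp [monicOfDegree]
  have hsub := monicOfDegree_inter_factoredMonics_two_subset (F := F) (2 * m) {P | IsInert P}
  rw [h] at hsub
  exact (Set.ncard_le_ncard hsub ((finite_monicOfDegree m).image _)).trans
    (Set.ncard_image_le (finite_monicOfDegree m))

end Finite

variable [Fintype F] [DecidableEq F]

variable (F) in
/-- The completely multiplicative extension of the quadratic character of the constant term: it
takes the value `1` at `T`, so that it is defined by the lowest nonzero coefficient. On monic
primes it is `-1` at the inert ones and `1` at all others. -/
noncomputable def trailingChar : F[X] →* ℝ where
  toFun f := (quadraticChar F f.trailingCoeff : ℝ)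
  map_one' := by rw [trailingCoeff_of_coeff_zero (by simp)]; simp
  map_mul' f g := by rw [trailingCoeff_mul, map_mul, Int.cast_mul]

lemma trailingChar_apply (f : F[X]) :
    trailingChar F f = (quadraticChar F f.trailingCoeff : ℝ) := rfl

lemma trailingChar_of_isInert {P : F[X]} (hi : IsInert P) : trailingChar F P = -1 := by
  have h0 : P.coeff 0 ≠ 0 := fun h => hi (h ▸ IsSquare.zero)
  rw [trailingChar_apply, trailingCoeff_of_coeff_zero h0,
    quadraticChar_neg_one_iff_not_isSquare.mpr hi]
  simp

lemma trailingChar_X : trailingChar F X = 1 := by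
  simp [trailingChar_apply, trailingCoeff]

lemma trailingChar_of_not_isInert {P : F[X]} (hm : P.Monic) (hP : Irreducible P)
    (hi : ¬ IsInert P) : trailingChar F P = 1 := by
  by_cases h0 : P.coeff 0 = 0
  · have : X = P := eq_of_monic_of_associated monic_X hm
      (Polynomial.irreducible_X.associated_of_dvd hP (X_dvd_iff.mpr h0))
    rw [← this, trailingChar_X]
  · rw [trailingChar_apply, trailingCoeff_of_coeff_zero h0,
      (quadraticChar_one_iff_isSquare h0).mpr (not_not.mp hi)]
    simp

/-- The L-function of the quadratic character of the constant term is trivial; with the Euler factor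
at `T` included it is `1 / (1 - u)`. -/
lemma coeff_monicSeries_trailingChar (hF : ringChar F ≠ 2) (n : ℕ) :
    PowerSeries.coeff n (monicSeries (trailingChar F) (factoredMonics Set.univ (fun _ => 1)))
      = 1 := by
  rw [coeff_monicSeries, monicOfDegree_inter_factoredMonics_one]
  induction n with
  | zero => rw [monicOfDegree_zero, finsum_mem_singleton, map_one]
  | succ n ih =>
    rw [finsum_monicOfDegree_succ, ← ih]
    refine finsum_mem_congr rfl fun g _ => ?_
    have h (c : F) : trailingChar F (X * g + C c)
        = (if c = 0 then trailingChar F g else 0) + (quadraticChar F c : ℝ) := by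
      split_ifs with hc
      · rw [hc, C_0, add_zero, map_mul, trailingChar_X, one_mul, quadraticChar_zero,
          Int.cast_zero, add_zero]
      · rw [zero_add, trailingChar_apply, trailingCoeff_of_coeff_zero (by simpa using hc)]
        simp
    simp_rw [h]
    rw [Finset.sum_add_distrib, Finset.sum_ite_eq' Finset.univ (0 : F), ← Int.cast_sum,
      quadraticChar_sum_zero hF]
    simp

/-- The square of the generating series of the polynomials `A² + T B²` is
`ζ(u) L(u) ∏ (1 - u ^ (2 deg P))⁻¹` with `P` running over the inert primes. The Euler factors
agree prime by prime: both sides have `(1 - u ^ deg P)⁻²` at non-inert and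
`(1 - u ^ (2 deg P))⁻²` at inert primes. -/
theorem monicSeries_sq :
    monicSeries (1 : F[X] →* ℝ) (factoredMonics Set.univ inertExponent)
        * monicSeries (1 : F[X] →* ℝ) (factoredMonics Set.univ inertExponent)
      = monicSeries (1 : F[X] →* ℝ) (factoredMonics Set.univ (fun _ => 1))
        * monicSeries (trailingChar F) (factoredMonics Set.univ (fun _ => 1))
        * monicSeries (1 : F[X] →* ℝ) (factoredMonics {P | IsInert P} (fun _ => 2)) := by
  classical
  ext N
  set S := primesUpTo F N with hSdef
  have hS : ∀ P ∈ S, P.Monic ∧ Irreducible P := fun P hP => (mem_primesUpTo.mp hP).1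
  have tr (w : F[X] →* ℝ) (e : F[X] → ℕ) : ∀ k ≤ N,
      PowerSeries.coeff k (monicSeries w (factoredMonics Set.univ e))
        = PowerSeries.coeff k (monicSeries w (factoredMonics (S : Set F[X]) e)) :=
    fun k hk => coeff_monicSeries_factoredMonics w _ e hk S (Set.univ_inter _).symm
  have trJ : ∀ k ≤ N,
      PowerSeries.coeff k (monicSeries (1 : F[X] →* ℝ)
          (factoredMonics {P | IsInert P} (fun _ => 2)))
        = PowerSeries.coeff k (monicSeries (1 : F[X] →* ℝ)
          (factoredMonics ((S.filter IsInert : Finset F[X]) : Set F[X]) (fun _ => 2))) :=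
    fun k hk => coeff_monicSeries_factoredMonics 1 _ _ hk _ (by
      ext P; simp [hSdef, and_comm])
  rw [coeff_mul_congr (tr 1 _) (tr 1 _) N le_rfl,
    coeff_mul_congr (coeff_mul_congr (tr 1 _) (tr (trailingChar F) _)) trJ N le_rfl]
  have hD := prod_mul_monicSeries (1 : F[X] →* ℝ) inertExponent S fun P hP =>
    ⟨(hS P hP).1, (hS P hP).2, by unfold inertExponent; split_ifs <;> norm_num⟩
  have hZ := prod_mul_monicSeries (1 : F[X] →* ℝ) (fun _ => 1) S fun P hP =>
    ⟨(hS P hP).1, (hS P hP).2, one_pos⟩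
  have hL := prod_mul_monicSeries (trailingChar F) (fun _ => 1) S fun P hP =>
    ⟨(hS P hP).1, (hS P hP).2, one_pos⟩
  have hJ := prod_mul_monicSeries (1 : F[X] →* ℝ) (fun _ => 2) (S.filter IsInert) fun P hP =>
    ⟨(hS P (Finset.mem_of_mem_filter P hP)).1, (hS P (Finset.mem_of_mem_filter P hP)).2, two_pos⟩
  rw [Finset.prod_filter] at hJ
  have key : (∏ P ∈ S, (1 - PowerSeries.C ((1 : F[X] →* ℝ) P ^ inertExponent P)
        * PowerSeries.X ^ (inertExponent P * P.natDegree))) ^ 2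
      = (∏ P ∈ S, (1 - PowerSeries.C ((1 : F[X] →* ℝ) P ^ 1)
          * PowerSeries.X ^ (1 * P.natDegree)))
        * (∏ P ∈ S, (1 - PowerSeries.C (trailingChar F P ^ 1)
          * PowerSeries.X ^ (1 * P.natDegree)))
        * (∏ P ∈ S, if IsInert P then (1 - PowerSeries.C ((1 : F[X] →* ℝ) P ^ 2)
          * PowerSeries.X ^ (2 * P.natDegree)) else 1) := by
    rw [← Finset.prod_pow, ← Finset.prod_mul_distrib, ← Finset.prod_mul_distrib]
    refine Finset.prod_congr rfl fun P hP => ?_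
    unfold inertExponent
    split_ifs with hi
    · rw [trailingChar_of_isInert hi]
      simp only [MonoidHom.one_apply, one_pow, pow_one, map_one, map_neg, one_mul, neg_mul,
        sub_neg_eq_add]
      rw [mul_comm 2, pow_mul]
      ring
    · rw [trailingChar_of_not_isInert (hS P hP).1 (hS P hP).2 hi]
      simp only [MonoidHom.one_apply, pow_one, map_one, one_mul, mul_one]
      ring
  set D := monicSeries (1 : F[X] →* ℝ) (factoredMonics (S : Set F[X]) inertExponent)
  set Z := monicSeries (1 : F[X] →* ℝ) (factoredMonics (S : Set F[X]) (fun _ => 1))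
  set L := monicSeries (trailingChar F) (factoredMonics (S : Set F[X]) (fun _ => 1))
  set J := monicSeries (1 : F[X] →* ℝ)
    (factoredMonics ((S.filter IsInert : Finset F[X]) : Set F[X]) (fun _ => 2))
  generalize (∏ P ∈ S, (1 - PowerSeries.C ((1 : F[X] →* ℝ) P ^ inertExponent P)
        * PowerSeries.X ^ (inertExponent P * P.natDegree))) = d at hD key
  generalize (∏ P ∈ S, (1 - PowerSeries.C ((1 : F[X] →* ℝ) P ^ 1)
          * PowerSeries.X ^ (1 * P.natDegree))) = z at hZ key
  generalize (∏ P ∈ S, (1 - PowerSeries.C (trailingChar F P ^ 1)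
          * PowerSeries.X ^ (1 * P.natDegree))) = l at hL key
  generalize (∏ P ∈ S, if IsInert P then (1 - PowerSeries.C ((1 : F[X] →* ℝ) P ^ 2)
          * PowerSeries.X ^ (2 * P.natDegree)) else 1) = j at hJ key
  congr 1
  calc D * D = D * D * ((z * Z) * (l * L) * (j * J)) := by rw [hZ, hL, hJ]; ring
    _ = D * D * (z * l * j) * (Z * L * J) := by ring
    _ = (d * D) ^ 2 * (Z * L * J) := by rw [← key]; ring
    _ = Z * L * J := by rw [hD]; ring

lemma two_mul_ncard_not_isSquare (hF : ringChar F ≠ 2) :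
    (2 * {c : F | ¬ IsSquare c}.ncard : ℝ) = Nat.card F - 1 := by
  classical
  have h (c : F) : (1 : ℤ) - quadraticChar F c
      = (if c = 0 then 1 else 0) + 2 * if ¬ IsSquare c then 1 else 0 := by
    by_cases hc : c = 0
    · simp [hc]
    · by_cases hs : IsSquare c
      · simp [hc, hs, (quadraticChar_one_iff_isSquare hc).mpr hs]
      · simp [hc, hs, quadraticChar_neg_one_iff_not_isSquare.mpr hs]
  have h2 := Finset.sum_congr (rfl : (Finset.univ : Finset F) = Finset.univ) fun c _ => h c
  rw [Finset.sum_sub_distrib, quadraticChar_sum_zero hF, Finset.sum_add_distrib,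
    ← Finset.mul_sum, Finset.sum_boole, Finset.sum_boole] at h2
  rw [Set.ncard_eq_toFinset_card', Set.toFinset_ofPred, Nat.card_eq_fintype_card]
  have h3 : (Finset.univ.filter fun c : F => c = 0).card = 1 := by simp [Finset.filter_eq']
  rw [h3] at h2
  have h4 : ((Fintype.card F : ℤ) : ℝ) = ((1 + 2 * ((Finset.univ.filter fun c : F =>
      ¬ IsSquare c).card : ℤ) : ℤ) : ℝ) := by
    congr 1
    simpa using h2
  push_cast at h4
  linarith

/-- The polynomials counted in degree `2` are `(T + c)²` with `c` one of the `(q - 1) / 2`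
nonsquares. -/
lemma coeff_two_inertSquareSeries (hF : ringChar F ≠ 2) :
    PowerSeries.coeff 2 (inertSquareSeries F) = ((Nat.card F : ℝ) - 1) / 2 := by
  rw [coeff_inertSquareSeries, ← two_mul_ncard_not_isSquare hF, mul_div_cancel_left₀ _ two_ne_zero]
  have h : monicOfDegree F 2 ∩ factoredMonics {P | IsInert P} (fun _ => 2)
      = (fun c : F => (X + C c) ^ 2) '' {c : F | ¬ IsSquare c} := by
    ext f
    constructor
    · intro hf
      obtain ⟨g, ⟨hg, hd⟩, rfl⟩ := monicOfDegree_inter_factoredMonics_two_subset 2 _ hf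
      have hg1 : g = X + C (g.coeff 0) := hg.eq_X_add_C (by omega)
      refine ⟨g.coeff 0, ?_, by simp only; rw [← hg1]⟩
      have hirr : Irreducible g := by
        rw [hg1]
        exact irreducible_of_degree_eq_one (degree_X_add_C _)
      exact (hf.2.2 g (by
        convert! (mem_normalizedFactors_iff_of_monic (hg.pow 2) hg hirr).mpr
          (dvd_pow_self g two_ne_zero))).1
    · rintro ⟨c, hc, rfl⟩
      have hm := monic_X_add_C c
      have hirr : Irreducible (X + C c) := irreducible_of_degree_eq_one (degree_X_add_C c)
      refine ⟨⟨hm.pow 2, by rw [natDegree_pow, natDegree_X_add_C]⟩,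
        pow_mem_factoredMonics hm hirr ?_ dvd_rfl⟩
      change ¬ IsSquare ((X + C c).coeff 0)
      simpa using hc
  rw [h, Set.InjOn.ncard_image]
  intro c hc c' hc' hcc
  have hm := monic_X_add_C c
  have hirr : Irreducible (X + C c) := irreducible_of_degree_eq_one (degree_X_add_C c)
  have hdvd : X + C c ∣ (X + C c') := hirr.prime.dvd_of_dvd_pow (n := 2) (by
    rw [← show (X + C c) ^ 2 = (X + C c') ^ 2 from hcc]; exact dvd_pow_self _ two_ne_zero)
  have := eq_of_monic_of_associated hm (monic_X_add_C c')
    (hirr.associated_of_dvd (irreducible_of_degree_eq_one (degree_X_add_C c')) hdvd)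
  simpa using this

end Identity

/-! ### The central binomial series -/

section CentralBinomial

/-- The power series `(1 - X) ^ (-1/2)`, with coefficients `4⁻ⁿ binom(2n, n)`. -/
noncomputable def invSqrtSeries : PowerSeries ℝ :=
  PowerSeries.mk fun n => 1 / 4 ^ n * ((2 * n).choose n : ℝ)

lemma coeff_invSqrtSeries (n : ℕ) :
    PowerSeries.coeff n invSqrtSeries = 1 / 4 ^ n * ((2 * n).choose n : ℝ) :=
  PowerSeries.coeff_mk _ _

lemma coeff_succ_invSqrtSeries (n : ℕ) :
    ((n : ℝ) + 1) * PowerSeries.coeff (n + 1) invSqrtSeries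
      = (n + 1 / 2) * PowerSeries.coeff n invSqrtSeries := by
  have h : (((n + 1) * (n + 1).centralBinom : ℕ) : ℝ)
      = ((2 * (2 * n + 1) * n.centralBinom : ℕ) : ℝ) :=
    congrArg _ (Nat.succ_mul_centralBinom_succ n)
  rw [Nat.centralBinom, Nat.centralBinom] at h
  push_cast at h
  rw [coeff_invSqrtSeries, coeff_invSqrtSeries, pow_succ]
  field_simp
  linear_combination 2 * h

/-- The square of `(1 - X) ^ (-1/2)` is the geometric series. Both `A` and `S = A²` satisfy
first-order linear differential equations, `(1 - X) A' = A / 2` and `(1 - X) S' = S`. -/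
lemma invSqrtSeries_mul_self : invSqrtSeries * invSqrtSeries = PowerSeries.mk 1 := by
  have h1 : (1 - PowerSeries.X) * PowerSeries.derivative ℝ invSqrtSeries
      = PowerSeries.C (1 / 2) * invSqrtSeries := by
    ext n
    rw [sub_mul, one_mul, map_sub, PowerSeries.coeff_C_mul]
    cases n with
    | zero =>
      have := coeff_succ_invSqrtSeries 0
      simp only [PowerSeries.coeff_zero_X_mul, PowerSeries.coeff_derivative]
      push_cast at *
      linarith
    | succ n =>
      have := coeff_succ_invSqrtSeries (n + 1)
      simp only [PowerSeries.coeff_succ_X_mul, PowerSeries.coeff_derivative]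
      push_cast at *
      linarith
  set S := invSqrtSeries * invSqrtSeries with hS
  have h2 : (1 - PowerSeries.X) * PowerSeries.derivative ℝ S = S := by
    rw [hS, Derivation.leibniz, smul_eq_mul, mul_add, mul_left_comm, h1]
    have : PowerSeries.C (1 / 2 : ℝ) + PowerSeries.C (1 / 2 : ℝ) = 1 := by
      rw [← map_add]; norm_num
    linear_combination (invSqrtSeries * invSqrtSeries) * this
  have h0 : PowerSeries.coeff 0 S = 1 := by
    simp [hS, PowerSeries.coeff_mul, coeff_invSqrtSeries]
  ext n
  rw [PowerSeries.coeff_mk, Pi.one_apply]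
  induction n with
  | zero => exact h0
  | succ n ih =>
    have h3 := congrArg (PowerSeries.coeff (R := ℝ) n) h2
    rw [sub_mul, one_mul, map_sub, PowerSeries.coeff_derivative, ih] at h3
    have h4 : PowerSeries.coeff n
        ((PowerSeries.X : PowerSeries ℝ) * PowerSeries.derivative ℝ S) = n := by
      cases n with
      | zero => simp
      | succ n => rw [PowerSeries.coeff_succ_X_mul, PowerSeries.coeff_derivative, ih]; simp
    rw [h4] at h3
    have : (n : ℝ) + 1 ≠ 0 := by positivity
    field_simp at h3
    have h5 : (PowerSeries.coeff (n + 1) S - 1) * ((n : ℝ) + 1) = 0 := by linarith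
    rcases mul_eq_zero.mp h5 with h | h
    · linarith
    · exact absurd h this

end CentralBinomial

/-! ### Square roots of power series with bounded coefficients -/

section Bounds

/-- The coefficients of `f` up to degree `n` are bounded by `c` in absolute value. -/
def CoeffBound (n : ℕ) (c : ℝ) (f : PowerSeries ℝ) : Prop :=
  ∀ k ≤ n, |PowerSeries.coeff k f| ≤ c

variable {n : ℕ} {c d : ℝ} {f g : PowerSeries ℝ}

lemma CoeffBound.add (hf : CoeffBound n c f) (hg : CoeffBound n d g) :
    CoeffBound n (c + d) (f + g) := fun k hk => by
  rw [map_add]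
  exact (abs_add_le _ _).trans (add_le_add (hf k hk) (hg k hk))

lemma CoeffBound.sub (hf : CoeffBound n c f) (hg : CoeffBound n d g) :
    CoeffBound n (c + d) (f - g) := fun k hk => by
  rw [map_sub]
  exact (abs_sub _ _).trans (add_le_add (hf k hk) (hg k hk))

lemma CoeffBound.mul (hf : CoeffBound n c f) (hg : CoeffBound n d g) :
    CoeffBound n ((n + 1) * (c * d)) (f * g) := fun k hk => by
  have hc : 0 ≤ c := (abs_nonneg _).trans (hf 0 n.zero_le)
  have hd : 0 ≤ d := (abs_nonneg _).trans (hg 0 n.zero_le)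
  rw [PowerSeries.coeff_mul]
  calc _ ≤ ∑ p ∈ Finset.HasAntidiagonal.antidiagonal k,
        |PowerSeries.coeff p.1 f * PowerSeries.coeff p.2 g| :=
        Finset.abs_sum_le_sum_abs _ _
    _ ≤ ∑ p ∈ Finset.HasAntidiagonal.antidiagonal k, c * d := by
        refine Finset.sum_le_sum fun p hp => ?_
        have := Finset.HasAntidiagonal.mem_antidiagonal.mp hp
        rw [abs_mul]
        exact mul_le_mul (hf _ (by omega)) (hg _ (by omega)) (abs_nonneg _) hc
    _ = (k + 1) * (c * d) := by
        rw [Finset.sum_const, Finset.Nat.card_antidiagonal, nsmul_eq_mul]; push_cast; rfl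
    _ ≤ _ := by gcongr

/-- If `f` has constant coefficient `2` and bounded coefficients, a bound for `z f` gives one for
`z`, because `z` can be solved for one coefficient at a time. -/
lemma abs_coeff_le_of_mul {z : PowerSeries ℝ} (h0 : PowerSeries.coeff 0 f = 2)
    (hf : CoeffBound n c f) (hz : CoeffBound n d (z * f)) :
    ∀ k ≤ n, |PowerSeries.coeff k z| ≤ d * (1 + c) ^ k := by
  have hc : 0 ≤ c := (abs_nonneg _).trans (hf 0 n.zero_le)
  have hd : 0 ≤ d := (abs_nonneg _).trans (hz 0 n.zero_le)
  intro k
  induction k using Nat.strong_induction_on with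
  | _ k ih =>
    intro hk
    have h1 := hz k hk
    rw [PowerSeries.coeff_mul, Finset.Nat.sum_antidiagonal_eq_sum_range_succ
      (fun i j => PowerSeries.coeff i z * PowerSeries.coeff j f), Finset.sum_range_succ,
      Nat.sub_self, h0] at h1
    have h2 : |∑ i ∈ Finset.range k, PowerSeries.coeff i z * PowerSeries.coeff (k - i) f|
        ≤ d * ((1 + c) ^ k - 1) := by
      calc _ ≤ ∑ i ∈ Finset.range k, |PowerSeries.coeff i z * PowerSeries.coeff (k - i) f| :=
            Finset.abs_sum_le_sum_abs _ _
        _ ≤ ∑ i ∈ Finset.range k, d * (1 + c) ^ i * c := by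
            refine Finset.sum_le_sum fun i hi => ?_
            have := Finset.mem_range.mp hi
            rw [abs_mul]
            exact mul_le_mul (ih i this (by omega)) (hf _ (by omega)) (abs_nonneg _)
              (by positivity)
        _ = d * ((∑ i ∈ Finset.range k, (1 + c) ^ i) * ((1 + c) - 1)) := by
            rw [Finset.sum_mul, Finset.mul_sum]
            exact Finset.sum_congr rfl fun _ _ => by ring
        _ = _ := by rw [geom_sum_mul]
    set s := ∑ i ∈ Finset.range k, PowerSeries.coeff i z * PowerSeries.coeff (k - i) f
    have h3 : |PowerSeries.coeff k z * 2| ≤ d + d * ((1 + c) ^ k - 1) := by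
      have : PowerSeries.coeff k z * 2 = (s + PowerSeries.coeff k z * 2) - s := by ring
      rw [this]
      exact (abs_sub _ _).trans (add_le_add h1 h2)
    rw [abs_mul, abs_two] at h3
    have h4 : 0 ≤ d * (1 + c) ^ k := by positivity
    linarith

/-- The square root of `(1 + ε X)(1 + (ε / 2) X²)` up to terms in `ε²`. -/
noncomputable def correctionSeries (ε : ℝ) : PowerSeries ℝ :=
  1 + PowerSeries.C (ε / 2) * PowerSeries.X + PowerSeries.C (ε / 4) * PowerSeries.X ^ 2

lemma coeffBound_invSqrtSeries (n : ℕ) : CoeffBound n 1 invSqrtSeries := fun k _ => by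
  rw [coeff_invSqrtSeries, abs_of_nonneg (by positivity), one_div, inv_mul_le_iff₀ (by positivity),
    mul_one]
  have : (2 * k).choose k ≤ 4 ^ k := by
    rw [show 4 = 2 ^ 2 by norm_num, ← pow_mul]; exact Nat.choose_le_two_pow _ _
  exact_mod_cast this

lemma coeffBound_quadratic (n : ℕ) {a b c : ℝ} (ha : |a| ≤ c) (hb : |b| ≤ c) (hc : 1 ≤ c) :
    CoeffBound n c (1 + PowerSeries.C a * PowerSeries.X + PowerSeries.C b * PowerSeries.X ^ 2) := by
  intro k _
  rcases k with _ | _ | _ | k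
  · simpa using hc
  · simpa [PowerSeries.coeff_one, PowerSeries.coeff_X, PowerSeries.coeff_X_pow] using ha
  · simpa [PowerSeries.coeff_one, PowerSeries.coeff_X, PowerSeries.coeff_X_pow] using hb
  · simpa [PowerSeries.coeff_one, PowerSeries.coeff_X, PowerSeries.coeff_X_pow] using
      zero_le_one.trans hc

/-- Perturbation of the square root: if `D² = G L J` with `G = 1 / (1 - X)`,
`L = 1 + ε X + O(ε²)` and `J = 1 + (ε / 2) X² + O(ε²)`, then
`D = (1 - X) ^ (-1/2) (1 + (ε / 2) X + (ε / 4) X²) + O(ε²)`, uniformly in `ε`. -/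
theorem abs_coeff_sub_le {D L J : PowerSeries ℝ} {ε : ℝ} (hε : 0 ≤ ε) (hε1 : ε ≤ 1)
    (hD0 : PowerSeries.coeff 0 D = 1) (hD : CoeffBound n 1 D) (hJ : CoeffBound n 1 J)
    (hl : CoeffBound n (ε ^ 2) (L - (1 + PowerSeries.C ε * PowerSeries.X)))
    (hj : CoeffBound n (ε ^ 2) (J - (1 + PowerSeries.C (ε / 2) * PowerSeries.X ^ 2)))
    (h : D * D = PowerSeries.mk 1 * L * J) :
    |PowerSeries.coeff n (D - invSqrtSeries * correctionSeries ε)|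
      ≤ (n + 1) * (2 * n + 6) * (n + 3) ^ n * ε ^ 2 := by
  have hW : CoeffBound n 1 (correctionSeries ε) :=
    coeffBound_quadratic n (by rw [abs_of_nonneg] <;> linarith)
      (by rw [abs_of_nonneg] <;> linarith) le_rfl
  have hlin : CoeffBound n 1 (1 + PowerSeries.C ε * PowerSeries.X) := by
    have := coeffBound_quadratic n (a := ε) (b := 0) (by rwa [abs_of_nonneg hε])
      (by simp) (le_refl 1)
    simpa using this
  have hε2 : 0 ≤ ε ^ 2 := sq_nonneg ε
  -- The cross terms of `L J` and of the square of the correction, both of order `ε²`.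
  have hw (a : ℝ) (m : ℕ) (ha : |a| ≤ 1) :
      CoeffBound n (ε ^ 2) (PowerSeries.C (ε ^ 2 * a) * PowerSeries.X ^ m) := by
    intro k _
    rw [PowerSeries.coeff_C_mul, PowerSeries.coeff_X_pow]
    split_ifs
    · rw [mul_one, abs_mul, abs_of_nonneg hε2]
      exact mul_le_of_le_one_right hε2 ha
    · simpa using hε2
  set l := L - (1 + PowerSeries.C ε * PowerSeries.X) with hl_def
  set j := J - (1 + PowerSeries.C (ε / 2) * PowerSeries.X ^ 2) with hj_def
  have key : L * J - correctionSeries ε ^ 2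
      = PowerSeries.C (ε ^ 2 * (1 / 2)) * PowerSeries.X ^ 3
        + (1 + PowerSeries.C ε * PowerSeries.X) * j + l * J
        - PowerSeries.C (ε ^ 2 * (1 / 4)) * PowerSeries.X ^ 2
        - PowerSeries.C (ε ^ 2 * (1 / 4)) * PowerSeries.X ^ 3
        - PowerSeries.C (ε ^ 2 * (1 / 16)) * PowerSeries.X ^ 4 := by
    rw [hl_def, hj_def, correctionSeries]
    have e1 : PowerSeries.C (ε / 2) = PowerSeries.C ε * PowerSeries.C (1 / 2 : ℝ) := by
      rw [← map_mul]; congr 1; ring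
    have e2 : PowerSeries.C (ε / 4) = PowerSeries.C ε * PowerSeries.C (1 / 2 : ℝ) ^ 2 := by
      rw [← map_pow, ← map_mul]; congr 1; ring
    have e3 : PowerSeries.C (1 / 4 : ℝ) = PowerSeries.C (1 / 2 : ℝ) ^ 2 := by
      rw [← map_pow]; congr 1; norm_num
    have e4 : PowerSeries.C (1 / 16 : ℝ) = PowerSeries.C (1 / 2 : ℝ) ^ 4 := by
      rw [← map_pow]; congr 1; norm_num
    have e5 : (2 : PowerSeries ℝ) * PowerSeries.C (1 / 2 : ℝ) = 1 := by
      rw [← map_ofNat PowerSeries.C 2, ← map_mul]; norm_num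
    simp only [map_mul, map_pow, e1, e2, e3, e4]
    generalize PowerSeries.C (1 / 2 : ℝ) = t at *
    generalize PowerSeries.C ε = E at *
    linear_combination
      -(E * PowerSeries.X + E * t * PowerSeries.X ^ 2 + E ^ 2 * t ^ 2 * PowerSeries.X ^ 3) * e5
  have hG : CoeffBound n 1 (PowerSeries.mk 1 : PowerSeries ℝ) := fun k _ => by simp
  have hLJ : CoeffBound n ((2 * n + 6) * ε ^ 2) (L * J - correctionSeries ε ^ 2) := by
    rw [key]
    intro k hk
    refine ((((((hw (1 / 2) 3 (by norm_num [abs_le])).add (hlin.mul hj)).add (hl.mul hJ)).sub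
      (hw (1 / 4) 2 (by norm_num [abs_le]))).sub (hw (1 / 4) 3 (by norm_num [abs_le]))).sub
      (hw (1 / 16) 4 (by norm_num [abs_le])) k hk).trans (le_of_eq (by ring))
  have hmul := hG.mul hLJ
  have hY := (coeffBound_invSqrtSeries n).mul hW
  have hfac : (D - invSqrtSeries * correctionSeries ε) * (D + invSqrtSeries * correctionSeries ε)
      = PowerSeries.mk 1 * (L * J - correctionSeries ε ^ 2) := by
    linear_combination h - correctionSeries ε ^ 2 * invSqrtSeries_mul_self
  rw [← hfac] at hmul
  refine (abs_coeff_le_of_mul ?_ (hD.add hY) hmul n le_rfl).trans (le_of_eq ?_)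
  · rw [map_add, hD0]
    simp [PowerSeries.coeff_mul, coeff_invSqrtSeries, correctionSeries]
    norm_num
  · ring

end Bounds

/-! ### The count of polynomials `A² + T B²` -/

section Count

variable {F : Type*} [Field F] [Finite F]

lemma coeff_monicSeries_inertExponent (hF : ringChar F ≠ 2) (n : ℕ) :
    PowerSeries.coeff n (monicSeries (1 : F[X] →* ℝ) (factoredMonics Set.univ inertExponent))
      = countRepresentable F n := by
  rw [coeff_monicSeries]
  simp only [MonoidHom.one_apply]
  rw [finsum_mem_one_eq_ncard ((finite_monicOfDegree n).inter_of_left _), countRepresentable]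
  congr 2
  ext f
  exact and_congr_right fun hf => (isRepresentable_iff hF hf.1).symm

lemma countRepresentable_le (n : ℕ) : countRepresentable F n ≤ Nat.card F ^ n := by
  rw [← ncard_monicOfDegree, countRepresentable]
  exact Set.ncard_le_ncard (fun f hf => hf.1) (finite_monicOfDegree n)

/-- After the substitution `u = ε X` with `ε = 1 / q`, the series of squares of products of inert
primes is `1 + (ε / 2) X² + O(ε²)`. -/
lemma abs_coeff_rescale_inertSquareSeries (hF : ringChar F ≠ 2) {ε : ℝ}
    (hε : ε = (Nat.card F : ℝ)⁻¹) (k : ℕ) :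
    |PowerSeries.coeff k (PowerSeries.rescale ε (inertSquareSeries F))| ≤ 1 ∧
    |PowerSeries.coeff k (PowerSeries.rescale ε (inertSquareSeries F)
      - (1 + PowerSeries.C (ε / 2) * PowerSeries.X ^ 2))| ≤ ε ^ 2 := by
  classical
  have := Fintype.ofFinite F
  have hq : (1 : ℝ) < Nat.card F := by exact_mod_cast Finite.one_lt_card
  have hq0 : (0 : ℝ) < Nat.card F := by linarith
  have hε0 : 0 < ε := by rw [hε]; positivity
  have hε1 : ε ≤ 1 := by rw [hε]; exact inv_le_one_of_one_le₀ hq.le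
  have hεq : ε * Nat.card F = 1 := by rw [hε]; exact inv_mul_cancel₀ hq0.ne'
  have hε2 : 0 ≤ ε ^ 2 := sq_nonneg ε
  rw [map_sub, map_add, PowerSeries.coeff_rescale, PowerSeries.coeff_C_mul,
    PowerSeries.coeff_X_pow, PowerSeries.coeff_one]
  rcases Nat.even_or_odd k with ⟨m, hm⟩ | hodd
  · obtain rfl : k = 2 * m := by omega
    have hle := coeff_inertSquareSeries_le (F := F) m
    have h0 : 0 ≤ PowerSeries.coeff (2 * m) (inertSquareSeries F) := by
      rw [coeff_inertSquareSeries]; positivity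
    have hb0 : 0 ≤ ε ^ (2 * m) * PowerSeries.coeff (2 * m) (inertSquareSeries F) := by positivity
    have hb : ε ^ (2 * m) * PowerSeries.coeff (2 * m) (inertSquareSeries F) ≤ ε ^ m := by
      calc _ ≤ ε ^ (2 * m) * (Nat.card F : ℝ) ^ m := by gcongr
        _ = ε ^ m * (ε * Nat.card F) ^ m := by ring
        _ = ε ^ m := by rw [hεq, one_pow, mul_one]
    refine ⟨by rw [abs_of_nonneg hb0]; exact hb.trans (pow_le_one₀ hε0.le hε1), ?_⟩
    rcases m with _ | _ | m
    · simp [coeff_zero_inertSquareSeries, hε2]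
    · simp only [zero_add, mul_one, coeff_two_inertSquareSeries hF]
      have : ε ^ 2 * (((Nat.card F : ℝ) - 1) / 2) = ε / 2 - ε ^ 2 / 2 := by
        linear_combination (ε / 2) * hεq
      rw [this]
      norm_num
      rw [abs_of_nonneg (by positivity)]
      linarith
    · rw [if_neg (by omega), if_neg (by omega), mul_zero, add_zero, sub_zero, abs_of_nonneg hb0]
      exact hb.trans (pow_le_pow_of_le_one hε0.le hε1 (by omega))
  · have h0 : k ≠ 0 := by rintro rfl; simp at hodd
    have h2 : k ≠ 2 := by rintro rfl; exact absurd hodd (by decide)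
    rw [coeff_inertSquareSeries_of_odd k hodd, if_neg h0, if_neg h2]
    simp [hε2]

lemma coeff_add_two_invSqrtSeries_mul_correctionSeries (m : ℕ) (ε : ℝ) :
    PowerSeries.coeff (m + 2) (invSqrtSeries * correctionSeries ε)
      = 1 / 4 ^ (m + 2) * ((2 * (m + 2)).choose (m + 2) : ℝ) + secondCoeff (m + 2) * ε := by
  have e : invSqrtSeries * correctionSeries ε = invSqrtSeries
      + PowerSeries.C (ε / 2) * (PowerSeries.X ^ 1 * invSqrtSeries)
      + PowerSeries.C (ε / 4) * (PowerSeries.X ^ 2 * invSqrtSeries) := by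
    rw [correctionSeries]; ring
  rw [e, map_add, map_add, PowerSeries.coeff_C_mul, PowerSeries.coeff_C_mul,
    PowerSeries.coeff_X_pow_mul', PowerSeries.coeff_X_pow_mul', if_pos (by omega),
    if_pos (by omega), coeff_invSqrtSeries, coeff_invSqrtSeries, coeff_invSqrtSeries, secondCoeff]
  simp only [Nat.add_sub_cancel, show m + 2 - 1 = m + 1 by omega]
  rw [pow_succ (4 : ℝ) m]
  field_simp
  ring

/-- The coefficient bound for the generating series of the representable polynomials, rescaled by
`ε = 1 / q`. -/
lemma abs_coeff_rescale_sub_le (hF : ringChar F ≠ 2) {ε : ℝ} (hε : ε = (Nat.card F : ℝ)⁻¹)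
    (n : ℕ) :
    |ε ^ n * countRepresentable F n
        - PowerSeries.coeff n (invSqrtSeries * correctionSeries ε)|
      ≤ (n + 1) * (2 * n + 6) * (n + 3) ^ n * ε ^ 2 := by
  classical
  have := Fintype.ofFinite F
  have hq : (1 : ℝ) < Nat.card F := by exact_mod_cast Finite.one_lt_card
  have hq0 : (0 : ℝ) < Nat.card F := by linarith
  have hε0 : 0 < ε := by rw [hε]; positivity
  have hε1 : ε ≤ 1 := by rw [hε]; exact inv_le_one_of_one_le₀ hq.le
  have hεq : ε * Nat.card F = 1 := by rw [hε]; exact inv_mul_cancel₀ hq0.ne'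
  set D := PowerSeries.rescale ε
    (monicSeries (1 : F[X] →* ℝ) (factoredMonics Set.univ inertExponent)) with hDdef
  have hcD (k : ℕ) : PowerSeries.coeff k D = ε ^ k * countRepresentable F k := by
    rw [hDdef, PowerSeries.coeff_rescale, coeff_monicSeries_inertExponent hF]
  have hZ : PowerSeries.rescale ε
      (monicSeries (1 : F[X] →* ℝ) (factoredMonics Set.univ (fun _ => 1))) = PowerSeries.mk 1 := by
    ext k
    rw [PowerSeries.coeff_rescale, coeff_monicSeries_one, ← mul_pow, hεq, one_pow,
      PowerSeries.coeff_mk, Pi.one_apply]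
  have hJ := abs_coeff_rescale_inertSquareSeries hF hε
  rw [← hcD, ← map_sub]
  refine abs_coeff_sub_le (J := PowerSeries.rescale ε (inertSquareSeries F))
    (L := PowerSeries.rescale ε (monicSeries (trailingChar F)
      (factoredMonics Set.univ (fun _ => 1)))) hε0.le hε1 ?_ (fun k _ => ?_)
    (fun k _ => (hJ k).1) (fun k _ => ?_) (fun k _ => (hJ k).2) ?_
  · rw [hcD, ← coeff_monicSeries_inertExponent hF, coeff_monicSeries, monicOfDegree_zero,
      Set.inter_eq_left.mpr, finsum_mem_singleton, map_one, pow_zero, one_mul]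
    rintro _ rfl
    exact ⟨monic_one, by simp⟩
  · rw [hcD, abs_of_nonneg (by positivity)]
    calc _ ≤ ε ^ k * (Nat.card F : ℝ) ^ k := by
          gcongr; exact_mod_cast countRepresentable_le k
      _ = 1 := by rw [← mul_pow, hεq, one_pow]
  · rw [map_sub, PowerSeries.coeff_rescale, coeff_monicSeries_trailingChar hF, mul_one, map_add,
      PowerSeries.coeff_C_mul, PowerSeries.coeff_X, PowerSeries.coeff_one]
    rcases k with _ | _ | k
    · simp [sq_nonneg]
    · simp [sq_nonneg]
    · rw [if_neg (by omega), if_neg (by omega), mul_zero, add_zero, sub_zero,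
        abs_of_nonneg (by positivity)]
      exact pow_le_pow_of_le_one hε0.le hε1 (by omega)
  · rw [← hZ, hDdef, ← map_mul, monicSeries_sq, map_mul, map_mul, inertSquareSeries]

end Count

end LandauFF

theorem theorem1p2 (n : ℕ) (hn : 2 ≤ n) :
    ∃ C : ℝ, ∀ (F : Type*) [Field F] [Finite F], Odd (Nat.card F) →
      |(LandauFF.countRepresentable F n : ℝ)
          - (1 / 4 ^ n * ((2 * n).choose n : ℝ) * (Nat.card F : ℝ) ^ n
            + LandauFF.secondCoeff n * (Nat.card F : ℝ) ^ (n - 1))|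
        ≤ C * (Nat.card F : ℝ) ^ (n - 2) := by
  refine ⟨(n + 1) * (2 * n + 6) * (n + 3) ^ n, fun F _ _ hodd => ?_⟩
  have := Fintype.ofFinite F
  have hF : ringChar F ≠ 2 := by
    intro h
    have := FiniteField.even_card_iff_char_two.mp h
    rw [← Nat.card_eq_fintype_card] at this
    exact absurd hodd (by rw [Nat.not_odd_iff]; exact this)
  obtain ⟨m, rfl⟩ : ∃ m, n = m + 2 := ⟨n - 2, by omega⟩
  have hq0 : (0 : ℝ) < Nat.card F := by exact_mod_cast Nat.card_pos
  have h := LandauFF.abs_coeff_rescale_sub_le hF rfl (m + 2)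
  rw [LandauFF.coeff_add_two_invSqrtSeries_mul_correctionSeries] at h
  simp only [show m + 2 - 1 = m + 1 by omega, Nat.add_sub_cancel]
  set q := (Nat.card F : ℝ)
  have h1 : q * q⁻¹ = 1 := mul_inv_cancel₀ hq0.ne'
  have h2 : q ^ (m + 2) * q⁻¹ ^ (m + 2) = 1 := by rw [← mul_pow, h1, one_pow]
  calc _ = |q ^ (m + 2) * (q⁻¹ ^ (m + 2) * LandauFF.countRepresentable F (m + 2)
          - (1 / 4 ^ (m + 2) * ((2 * (m + 2)).choose (m + 2) : ℝ)
            + LandauFF.secondCoeff (m + 2) * q⁻¹))| := by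
        congr 1
        linear_combination (-(LandauFF.countRepresentable F (m + 2) : ℝ)) * h2
          + LandauFF.secondCoeff (m + 2) * q ^ (m + 1) * h1
    _ ≤ q ^ (m + 2) * (((m + 2 : ℕ) + 1) * (2 * (m + 2 : ℕ) + 6) * ((m + 2 : ℕ) + 3) ^ (m + 2)
          * q⁻¹ ^ 2) := by
        rw [abs_mul, abs_of_nonneg (pow_nonneg hq0.le _)]
        exact mul_le_mul_of_nonneg_left h (pow_nonneg hq0.le _)
    _ = _ := by
        rw [pow_add q m 2, mul_comm (_ * _ * _) (q⁻¹ ^ 2), mul_assoc, ← mul_assoc (q ^ 2),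
          ← mul_pow, h1, one_pow, one_mul, mul_comm]
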